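/- Let $H_0$ and $V$ be bounded self-adjoint operators on a complex Hilbert space, with $V$ of trace class, and let $H = H_0 + V$. For $\lambda$ in the resolvent set of $H_0$ put $R_0(\lambda) = (H_0-\lambda)^{-1}$ and let $D(\lambda) = \det(I + V R_0(\lambda))$ be the Fredholm determinant. Then $H^n - H_0^n$ is of trace class for every $n \ge 1$; put $F_n = \operatorname{Tr}(H^n - H_0^n)$. There is $r_0 > 0$ such that every $\lambda \in \mathbb{C}$ with $|\lambda| \ge r_0$ lies in the resolvent set of $H_0$, $D(\lambda) \notin (-\infty, 0]$ for these $\lambda$, and, with the principal branch of the logarithm, $$\log D(\lambda) = -\sum_{n=1}^{\infty} \frac{F_n}{n}\,\lambda^{-n},$$ where the series converges uniformly on $\{\lambda \in \mathbb{C} : |\lambda| \ge r_0\}$. In particular, $F_1 = \operatorname{Tr} V$, and $F_2 = \operatorname{Tr}(2 V H_0 + V^2)$, the operator $2VH_0 + V^2$ being of trace class. -/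

import Mathlib

open Filter Topology
open scoped InnerProductSpace

namespace TraceFormula

noncomputable section

variable {E : Type*} [NormedAddCommGroup E] [InnerProductSpace ℂ E] [CompleteSpace E]

/-- A bounded operator `K` on a Hilbert space is of trace class if `Tr |K| < ∞`, where
`|K| = (K* K)^{1/2}`: the series of nonnegative numbers `∑ ⟪e, |K| e⟫` over some orthonormal basis
(equivalently, over every one) converges. -/
def IsTraceClass (K : E →L[ℂ] E) : Prop :=
  ∃ (s : Set E) (e : HilbertBasis s ℂ E), Summable fun i : s => (⟪e i, CFC.abs K (e i)⟫_ℂ).re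

/-- The trace `Tr K = ∑ ⟪b i, K (b i)⟫` of a trace class operator `K`, computed in the orthonormal
basis `b`. The results are stated for every `b`. -/
def trace {ι : Type*} (b : HilbertBasis ι ℂ E) (K : E →L[ℂ] E) : ℂ :=
  ∑' i, ⟪b i, K (b i)⟫_ℂ

/-- The finite section of `K`: the matrix of the compression of `K` to the span of
`b i`, `i ∈ F`. -/
def finiteSection {ι : Type*} (b : HilbertBasis ι ℂ E) (K : E →L[ℂ] E) (F : Finset ι) :
    Matrix F F ℂ :=
  Matrix.of fun i j => ⟪b i, K (b j)⟫_ℂ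

open Classical in
/-- The Fredholm determinant `det (I + K)` of a trace class operator `K`: the limit of the
determinants `det (I + P_F K P_F)` of its finite sections, as the finite set `F` of basis indices
increases (`P_F` is the orthogonal projection onto the span of `b i`, `i ∈ F`). -/
def fredholmDet {ι : Type*} (b : HilbertBasis ι ℂ E) (K : E →L[ℂ] E) : ℂ :=
  limUnder atTop fun F : Finset ι => (1 + finiteSection b K F).det

/-- The resolvent `R₀(z) = (H₀ - z)⁻¹`, for `z` in the resolvent set of `H₀`. -/
def freeResolvent (H₀ : E →L[ℂ] E) (z : ℂ) : E →L[ℂ] E :=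
  Ring.inverse (H₀ - z • (1 : E →L[ℂ] E))

/-- The perturbation determinant `D(z) = det (I + V R₀(z))`, for `z` in the resolvent set
of `H₀`. -/
def perturbationDet {ι : Type*} (b : HilbertBasis ι ℂ E) (H₀ V : E →L[ℂ] E) (z : ℂ) : ℂ :=
  fredholmDet b (V * freeResolvent H₀ z)

/-- `F_n = Tr (Hⁿ - H₀ⁿ)`, where `H = H₀ + V`. -/
def momentCoeff {ι : Type*} (b : HilbertBasis ι ℂ E) (H₀ V : E →L[ℂ] E) (n : ℕ) : ℂ :=
  trace b ((H₀ + V) ^ n - H₀ ^ n)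

end

end TraceFormula

/-!
The idea is that, with `w = 1 / z`, `H = H₀ + V` and `G = (1 - w H₀)⁻¹`,
`I + V R₀(z) = I - w V G = (I - w H) (I - w H₀)⁻¹`, so that formally
`log D(z) = Tr (log (I - w H) - log (I - w H₀)) = -∑ wⁿ Tr (Hⁿ - H₀ⁿ) / n`.
The logarithms of `I - w H` and `I - w H₀` are in general not of trace class separately, so the computation is
made for compressions `P H P` and `P H₀ P` to finite sets of basis vectors, where
`det (1 - M) = exp (-∑ tr (Mⁿ) / n)` for every matrix `M` of spectral radius less than one
(`Matrix.summable_and_det_one_sub_eq_exp`), and then `P → I`.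

The passage to the limit rests on two facts. A self-adjoint trace class operator is an absolutely
convergent sum of rank one operators (`IsTraceClass.exists_isNuclearExpansion`), and for such a `V`
the trace of `A V B` is continuous in `A` and `B` for bounded strong-* convergence, by dominated
convergence (`IsNuclearExpansion.tendsto_trace`). Since strong-* convergence passes to products and
to uniformly bounded inverses, it applies both to the compressions of `w V G`, whose determinants
define `D`, and to `w P V P (1 - w P H₀ P)⁻¹`, whose determinant is the quotient
`det (1 - w P H P) / det (1 - w P H₀ P)`. Both have the limit `exp (-∑ Tr ((w V G)ⁿ) / n)`, while
the quotient also tends to `exp (-∑ wⁿ Tr (Hⁿ - H₀ⁿ) / n)`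
(`tendsto_det_one_sub_finiteSection`).

The bound `|Tr (Hⁿ - H₀ⁿ)| ≤ n N rⁿ⁻¹`, with `r = ‖H₀‖ + ‖V‖` and `N` the sum of the norms of the
rank one terms of `V`, gives uniform convergence by the Weierstrass test, and keeps the series
below `π` in absolute value for large `z`, so that the exponential is inverted by the principal
logarithm. Conversely, operators with a nuclear expansion are of trace class; the polar
decomposition is replaced by an approximate one (`exists_norm_abs_sub_mul_le`).
-/

/-! ### The logarithm of a determinant -/

namespace Matrix

open Polynomial

variable {n : Type*} [Fintype n] [DecidableEq n]

lemma det_scalar_sub_eq_prod_roots (M : Matrix n n ℂ) (x : ℂ) :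
    (x • (1 : Matrix n n ℂ) - M).det = (M.charpoly.roots.map fun μ => x - μ).prod := by
  have h : M.charpoly = (M.charpoly.roots.map fun μ => X - C μ).prod := by
    simpa [M.charpoly_monic.leadingCoeff] using (IsAlgClosed.splits M.charpoly).eq_prod_roots
  have h2 : M.charpoly.eval x = (x • (1 : Matrix n n ℂ) - M).det := by
    rw [eval_charpoly, scalar_apply, ← smul_one_eq_diagonal]
  rw [← h2]
  conv_lhs => rw [h]
  rw [eval_multiset_prod, Multiset.map_map]
  simp

lemma det_aeval_eq_prod_roots (M : Matrix n n ℂ) (p : ℂ[X]) :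
    (aeval M p).det = (M.charpoly.roots.map fun μ => p.eval μ).prod := by
  have hcard : Multiset.card M.charpoly.roots = Fintype.card n := by
    rw [splits_iff_card_roots.mp (IsAlgClosed.splits M.charpoly), charpoly_natDegree_eq_dim]
  have hfac (s : Multiset ℂ) : (aeval M (s.map fun α => X - C α).prod).det =
      (M.charpoly.roots.map fun μ => (s.map fun α => X - C α).prod.eval μ).prod := by
    induction s using Multiset.induction_on with
    | empty => simp
    | cons α s ih =>
      have hα : (M - α • (1 : Matrix n n ℂ)).det = (M.charpoly.roots.map fun μ => μ - α).prod := by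
        rw [← neg_sub, det_neg, det_scalar_sub_eq_prod_roots, ← hcard,
          ← Multiset.card_map (fun μ => α - μ), ← Multiset.prod_map_neg, Multiset.map_map]
        simp
      simp only [Multiset.map_cons, Multiset.prod_cons, map_mul, det_mul, ih, eval_mul,
        Multiset.prod_map_mul]
      simp [Algebra.algebraMap_eq_smul_one, hα]
  rw [(IsAlgClosed.splits p).eq_prod_roots]
  simp only [map_mul, det_mul, hfac, eval_mul, Multiset.prod_map_mul, eval_C]
  simp [Algebra.algebraMap_eq_smul_one, hcard]

/-- The eigenvalues of `M ^ k`, with multiplicity, are the `k`-th powers of those of `M`. -/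
lemma roots_charpoly_pow (M : Matrix n n ℂ) (k : ℕ) :
    (M ^ k).charpoly.roots = M.charpoly.roots.map (· ^ k) := by
  have h : (M ^ k).charpoly = ((M.charpoly.roots.map (· ^ k)).map fun a => X - C a).prod := by
    refine Polynomial.funext fun x => ?_
    have h1 := det_aeval_eq_prod_roots M (C x - X ^ k)
    simp only [map_sub, map_pow, aeval_X, aeval_C, Algebra.algebraMap_eq_smul_one, eval_sub,
      eval_pow, eval_X, eval_C] at h1
    rw [eval_charpoly, scalar_apply, ← smul_one_eq_diagonal, h1, eval_multiset_prod, Multiset.map_map,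
      Multiset.map_map]
    simp
  rw [h, roots_multiset_prod_X_sub_C]

lemma trace_pow_eq_sum_roots (M : Matrix n n ℂ) (k : ℕ) :
    (M ^ k).trace = (M.charpoly.roots.map (· ^ k)).sum := by
  rw [trace_eq_sum_roots_charpoly, roots_charpoly_pow]

/-- `det (1 - M) = exp (-∑ tr (Mⁿ) / n)` for a matrix of spectral radius less than one. The term
`n = 0` of the series vanishes, as `x / 0 = 0`. -/
lemma summable_and_det_one_sub_eq_exp (M : Matrix n n ℂ) (hM : ∀ μ ∈ M.charpoly.roots, ‖μ‖ < 1) :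
    Summable (fun k : ℕ => (M ^ k).trace / k) ∧
      (1 - M).det = Complex.exp (-∑' k : ℕ, (M ^ k).trace / k) := by
  have key (s : Multiset ℂ) (hs : ∀ μ ∈ s, ‖μ‖ < 1) :
      HasSum (fun k : ℕ => (s.map (· ^ k)).sum / k)
        (-(s.map fun μ => Complex.log (1 - μ)).sum) ∧
      (s.map fun μ => 1 - μ).prod = Complex.exp (s.map fun μ => Complex.log (1 - μ)).sum := by
    induction s using Multiset.induction_on with
    | empty => simp [hasSum_zero]
    | cons μ s ih =>
      obtain ⟨h1, h2⟩ := ih fun ν hν => hs ν (Multiset.mem_cons_of_mem hν)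
      have hμ := hs μ (Multiset.mem_cons_self μ s)
      refine ⟨?_, ?_⟩
      · convert (Complex.hasSum_taylorSeries_neg_log hμ).add h1 using 1
        · ext k; simp [add_div]
        · simp; ring
      · rw [Multiset.map_cons, Multiset.prod_cons, h2, Multiset.map_cons, Multiset.sum_cons,
          Complex.exp_add, Complex.exp_log]
        intro h
        rw [sub_eq_zero] at h
        simp [← h] at hμ
  obtain ⟨h1, h2⟩ := key _ hM
  have h3 := det_scalar_sub_eq_prod_roots M 1
  rw [one_smul] at h3
  simp only [trace_pow_eq_sum_roots, h1.tsum_eq, neg_neg]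
  exact ⟨h1.summable, by rw [h3, h2]⟩

end Matrix

/-! ### Nuclear expansions and trace class operators -/

namespace TraceFormula

open ContinuousLinearMap

section Nuclear

variable {E : Type*} [NormedAddCommGroup E] [InnerProductSpace ℂ E]

/-- `K = ∑ ⟪u k, ·⟫ v k` is a sum of rank one operators, absolutely convergent in operator norm. -/
structure IsNuclearExpansion {κ : Type*} (u v : κ → E) (K : E →L[ℂ] E) : Prop where
  summable_norm : Summable fun k => ‖u k‖ * ‖v k‖
  hasSum_apply : ∀ x, HasSum (fun k => ⟪u k, x⟫_ℂ • v k) (K x)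

lemma sum_norm_inner_mul_inner_le {ι : Type*} {e : ι → E} (he : Orthonormal ℂ e) (x y : E)
    (F : Finset ι) : ∑ i ∈ F, ‖⟪x, e i⟫_ℂ * ⟪e i, y⟫_ℂ‖ ≤ ‖x‖ * ‖y‖ := by
  have hx := he.sum_inner_products_le x (s := F)
  have hy := he.sum_inner_products_le y (s := F)
  simp only [norm_mul]
  refine (Real.sum_mul_le_sqrt_mul_sqrt F _ _).trans ?_
  gcongr
  · refine Real.sqrt_le_iff.mpr ⟨norm_nonneg x, ?_⟩
    simpa only [norm_inner_symm x] using hx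
  · exact Real.sqrt_le_iff.mpr ⟨norm_nonneg y, hy⟩

namespace IsNuclearExpansion

variable {κ : Type*} {u v : κ → E} {K : E →L[ℂ] E}

lemma mul_mul [CompleteSpace E] (h : IsNuclearExpansion u v K) (A B : E →L[ℂ] E) :
    IsNuclearExpansion (fun k => adjoint B (u k)) (fun k => A (v k)) (A * K * B) where
  summable_norm := by
    refine Summable.of_nonneg_of_le (fun k => by positivity) (fun k => ?_)
      (h.summable_norm.mul_left (‖B‖ * ‖A‖))
    calc _ ≤ (‖adjoint B‖ * ‖u k‖) * (‖A‖ * ‖v k‖) := by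
          gcongr <;> exact le_opNorm _ _
      _ = _ := by rw [LinearIsometryEquiv.norm_map]; ring
  hasSum_apply x := by
    simpa [adjoint_inner_left] using A.hasSum (h.hasSum_apply (B x))

lemma add {κ' : Type*} {u' v' : κ' → E} {K' : E →L[ℂ] E} (h : IsNuclearExpansion u v K)
    (h' : IsNuclearExpansion u' v' K') :
    IsNuclearExpansion (Sum.elim u u') (Sum.elim v v') (K + K') where
  summable_norm := Summable.sum _ h.summable_norm h'.summable_norm
  hasSum_apply x := HasSum.sum (f := fun k => ⟪Sum.elim u u' k, x⟫_ℂ • Sum.elim v v' k)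
    (h.hasSum_apply x) (h'.hasSum_apply x)

lemma neg (h : IsNuclearExpansion u v K) : IsNuclearExpansion u (fun k => -v k) (-K) where
  summable_norm := by simpa using h.summable_norm
  hasSum_apply x := by simpa using (h.hasSum_apply x).neg

lemma hasSum_inner (h : IsNuclearExpansion u v K) (x y : E) :
    HasSum (fun k => ⟪u k, x⟫_ℂ * ⟪y, v k⟫_ℂ) ⟪y, K x⟫_ℂ := by
  simpa using (innerSL ℂ y).hasSum (h.hasSum_apply x)

/-- The diagonal of a nuclear operator is absolutely summable, with a bound that does not depend
on the orthonormal system. -/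
lemma sum_norm_inner_le (h : IsNuclearExpansion u v K) {ι : Type*} {e : ι → E}
    (he : Orthonormal ℂ e) (F : Finset ι) :
    ∑ i ∈ F, ‖⟪e i, K (e i)⟫_ℂ‖ ≤ ∑' k, ‖u k‖ * ‖v k‖ := by
  have hs (i : ι) : Summable fun k => ‖⟪u k, e i⟫_ℂ * ⟪e i, v k⟫_ℂ‖ := by
    refine Summable.of_nonneg_of_le (fun k => norm_nonneg _) (fun k => ?_) h.summable_norm
    simpa using sum_norm_inner_mul_inner_le he (u k) (v k) {i}
  calc ∑ i ∈ F, ‖⟪e i, K (e i)⟫_ℂ‖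
      ≤ ∑ i ∈ F, ∑' k, ‖⟪u k, e i⟫_ℂ * ⟪e i, v k⟫_ℂ‖ := by
        refine Finset.sum_le_sum fun i _ => ?_
        rw [← (h.hasSum_inner (e i) (e i)).tsum_eq]
        exact norm_tsum_le_tsum_norm (hs i)
    _ = ∑' k, ∑ i ∈ F, ‖⟪u k, e i⟫_ℂ * ⟪e i, v k⟫_ℂ‖ :=
        (Summable.tsum_finsetSum fun i _ => hs i).symm
    _ ≤ ∑' k, ‖u k‖ * ‖v k‖ :=
        (summable_sum fun i _ => hs i).tsum_le_tsum
          (fun k => sum_norm_inner_mul_inner_le he _ _ F) h.summable_norm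

/-- The trace of a nuclear operator can be computed in any orthonormal basis. -/
lemma hasSum_trace (h : IsNuclearExpansion u v K) {ι : Type*} (b : HilbertBasis ι ℂ E) :
    HasSum (fun i => ⟪b i, K (b i)⟫_ℂ) (∑' k, ⟪u k, v k⟫_ℂ) := by
  have hs : Summable fun p : κ × ι => ⟪u p.1, b p.2⟫_ℂ * ⟪b p.2, v p.1⟫_ℂ := by
    apply Summable.of_norm
    have hrow (k : κ) : Summable fun i => ‖⟪u k, b i⟫_ℂ * ⟪b i, v k⟫_ℂ‖ :=
      summable_of_sum_le (fun i => norm_nonneg _) (sum_norm_inner_mul_inner_le b.orthonormal _ _)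
    have hle (k : κ) : ∑' i, ‖⟪u k, b i⟫_ℂ * ⟪b i, v k⟫_ℂ‖ ≤ ‖u k‖ * ‖v k‖ :=
      (hrow k).tsum_le_of_sum_le (sum_norm_inner_mul_inner_le b.orthonormal _ _)
    refine (summable_prod_of_nonneg (fun p => norm_nonneg _)).mpr ⟨hrow, ?_⟩
    exact Summable.of_nonneg_of_le (fun k => tsum_nonneg fun i => norm_nonneg _) hle
      h.summable_norm
  have h1 : HasSum (fun p : κ × ι => ⟪u p.1, b p.2⟫_ℂ * ⟪b p.2, v p.1⟫_ℂ)
      (∑' k, ⟪u k, v k⟫_ℂ) := by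
    have h2 := hs.hasSum
    rwa [← (h2.prod_fiberwise fun k => b.hasSum_inner_mul_inner (u k) (v k)).tsum_eq] at h2
  exact ((Equiv.prodComm ι κ).hasSum_iff.mpr h1).prod_fiberwise
    fun i => h.hasSum_inner (b i) (b i)

lemma trace_eq (h : IsNuclearExpansion u v K) {ι : Type*} (b : HilbertBasis ι ℂ E)
    [CompleteSpace E] : trace b K = ∑' k, ⟪u k, v k⟫_ℂ :=
  (h.hasSum_trace b).tsum_eq

lemma norm_trace_le [CompleteSpace E] (h : IsNuclearExpansion u v K) {ι : Type*}
    (b : HilbertBasis ι ℂ E) : ‖trace b K‖ ≤ ∑' k, ‖u k‖ * ‖v k‖ := by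
  rw [h.trace_eq b]
  exact tsum_of_norm_bounded h.summable_norm.hasSum fun k => norm_inner_le_norm _ _

end IsNuclearExpansion

end Nuclear

section TraceClass

variable {E : Type*} [NormedAddCommGroup E] [InnerProductSpace ℂ E] [CompleteSpace E]

/-- If `A ≥ 0` has summable diagonal in the orthonormal basis `e`, then
`A = ∑ ⟪√A e i, ·⟫ √A e i`. -/
lemma IsNuclearExpansion.of_nonneg {ι : Type*} (e : HilbertBasis ι ℂ E) {A : E →L[ℂ] E}
    (hA : 0 ≤ A) (hs : Summable fun i => (⟪e i, A (e i)⟫_ℂ).re) :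
    IsNuclearExpansion (fun i => CFC.sqrt A (e i)) (fun i => CFC.sqrt A (e i)) A := by
  have hsa : adjoint (CFC.sqrt A) = CFC.sqrt A :=
    ((nonneg_iff_isPositive _).mp (CFC.sqrt_nonneg A)).isSelfAdjoint.adjoint_eq
  have hmul (x : E) : CFC.sqrt A (CFC.sqrt A x) = A x := by
    rw [← mul_apply_eq_comp, CFC.sqrt_mul_sqrt_self A hA]
  have hinner (x y : E) : ⟪CFC.sqrt A x, y⟫_ℂ = ⟪x, CFC.sqrt A y⟫_ℂ := by
    rw [← adjoint_inner_right, hsa]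
  refine ⟨?_, fun x => ?_⟩
  · convert hs using 2 with i
    rw [← hmul, ← hinner, ← pow_two]
    exact norm_sq_eq_re_inner (𝕜 := ℂ) _
  · have h := (CFC.sqrt A).hasSum (e.hasSum_repr (CFC.sqrt A x))
    rw [hmul] at h
    simpa [e.repr_apply_apply, hinner] using h

/-- A self-adjoint trace class operator is nuclear, because its positive and negative parts are
dominated by its absolute value. -/
lemma IsTraceClass.exists_isNuclearExpansion {V : E →L[ℂ] E} (hV : IsSelfAdjoint V)
    (h : IsTraceClass V) : ∃ (s : Set E) (u v : s ⊕ s → E), IsNuclearExpansion u v V := by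
  obtain ⟨s, e, hs⟩ := h
  have hadd := CFC.posPart_add_negPart V hV
  have hpos (A : E →L[ℂ] E) (hA : 0 ≤ A) (x : E) : 0 ≤ (⟪x, A x⟫_ℂ).re :=
    ((nonneg_iff_isPositive _).mp hA).re_inner_nonneg_right x
  have hp := CFC.posPart_nonneg V
  have hn := CFC.negPart_nonneg V
  have hre (x : E) : (⟪x, CFC.abs V x⟫_ℂ).re = (⟪x, V⁺ x⟫_ℂ).re + (⟪x, V⁻ x⟫_ℂ).re := by
    rw [← hadd]
    simp
  have hps : Summable fun i => (⟪e i, V⁺ (e i)⟫_ℂ).re :=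
    Summable.of_nonneg_of_le (fun i => hpos _ hp _)
      (fun i => by linarith [hre (e i), hpos _ hn (e i)]) hs
  have hns : Summable fun i => (⟪e i, V⁻ (e i)⟫_ℂ).re :=
    Summable.of_nonneg_of_le (fun i => hpos _ hn _)
      (fun i => by linarith [hre (e i), hpos _ hp (e i)]) hs
  have h1 := (IsNuclearExpansion.of_nonneg e hp hps).add (IsNuclearExpansion.of_nonneg e hn hns).neg
  rw [← sub_eq_add_neg, CFC.posPart_sub_negPart V hV] at h1
  exact ⟨s, _, _, h1⟩

/-- Up to `ε`, the absolute value of `K` is `W * K` for a contraction `W`. This replaces the polar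
decomposition: `W = (|K| + ε)⁻¹ K*`. -/
lemma exists_norm_abs_sub_mul_le (K : E →L[ℂ] E) {ε : ℝ} (hε : 0 < ε) :
    ∃ W : E →L[ℂ] E, ‖W‖ ≤ 1 ∧ ‖CFC.abs K - W * K‖ ≤ ε := by
  set A := CFC.abs K with hAdef
  have hA : 0 ≤ A := CFC.abs_nonneg K
  have hAsa : IsSelfAdjoint A := hA.isSelfAdjoint
  have hsq : A * A = star K * K := CFC.abs_mul_abs K
  have hspec : ∀ x ∈ spectrum ℝ A, 0 ≤ x := fun x hx => spectrum_nonneg_of_nonneg hA hx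
  have hcont : ContinuousOn (fun x : ℝ => (x + ε)⁻¹) (spectrum ℝ A) :=
    ContinuousOn.inv₀ (by fun_prop) fun x hx => by have := hspec x hx; positivity
  set G := cfc (fun x : ℝ => (x + ε)⁻¹) A with hG
  have hGsa : star G = G := (cfc_predicate (R := ℝ) _ A : IsSelfAdjoint G).star_eq
  have hid : A = cfc (fun x : ℝ => x) A := (cfc_id' ℝ A).symm
  have hGAA : G * (A * A) = cfc (fun x : ℝ => (x + ε)⁻¹ * (x * x)) A := by
    rw [hG]
    nth_rewrite 2 3 [hid]
    rw [← cfc_mul (fun x : ℝ => x) (fun x : ℝ => x) A, ← cfc_mul _ _ A hcont (by fun_prop)]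
  refine ⟨G * star K, ?_, ?_⟩
  · have h1 : ‖G * star K‖ * ‖G * star K‖ ≤ 1 := by
      rw [← CStarRing.norm_self_mul_star]
      have h2 : G * star K * star (G * star K) =
          cfc (fun x : ℝ => (x + ε)⁻¹ * (x * x) * (x + ε)⁻¹) A := by
        rw [cfc_mul _ _ A (by fun_prop) hcont, ← hGAA, hsq, star_mul, star_star, hGsa, ← hG]
        simp only [mul_assoc]
      rw [h2]
      refine norm_cfc_le zero_le_one fun x hx => ?_
      have hx0 := hspec x hx
      have hxe : 0 < x + ε := by positivity
      rw [Real.norm_of_nonneg (by positivity), show (x + ε)⁻¹ * (x * x) * (x + ε)⁻¹ =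
        (x * x) / ((x + ε) * (x + ε)) by field_simp, div_le_one (by positivity)]
      nlinarith
    nlinarith [norm_nonneg (G * star K)]
  · rw [mul_assoc, ← hsq, hGAA]
    nth_rewrite 1 [hid]
    rw [← cfc_sub _ _ A (by fun_prop) (by fun_prop)]
    refine norm_cfc_le hε.le fun x hx => ?_
    have hx0 := hspec x hx
    have hxe : 0 < x + ε := by positivity
    rw [show x - (x + ε)⁻¹ * (x * x) = x * ε / (x + ε) by field_simp; ring,
      Real.norm_of_nonneg (by positivity), div_le_iff₀ hxe]
    nlinarith

lemma isTraceClass_of_bound {K : E →L[ℂ] E} {C : ℝ}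
    (h : ∀ W : E →L[ℂ] E, ‖W‖ ≤ 1 → ∀ (s : Set E) (e : HilbertBasis s ℂ E) (F : Finset s),
      ∑ i ∈ F, ‖⟪e i, W (K (e i))⟫_ℂ‖ ≤ C) : IsTraceClass K := by
  obtain ⟨s, e, -⟩ := exists_hilbertBasis ℂ E
  refine ⟨s, e, summable_of_sum_le (c := C) (fun i => ?_) fun F => ?_⟩
  · exact ((nonneg_iff_isPositive _).mp (CFC.abs_nonneg K)).re_inner_nonneg_right _
  · have hF (ε : ℝ) (hε : 0 < ε) :
        ∑ i ∈ F, (⟪e i, CFC.abs K (e i)⟫_ℂ).re ≤ C + ε * F.card := by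
      obtain ⟨W, hW, hWK⟩ := exists_norm_abs_sub_mul_le K hε
      calc ∑ i ∈ F, (⟪e i, CFC.abs K (e i)⟫_ℂ).re
          ≤ ∑ i ∈ F, (‖⟪e i, W (K (e i))⟫_ℂ‖ + ε) := by
            refine Finset.sum_le_sum fun i _ => ?_
            have he : ‖e i‖ = 1 := e.orthonormal.1 i
            have h1 : ⟪e i, CFC.abs K (e i)⟫_ℂ =
                ⟪e i, W (K (e i))⟫_ℂ + ⟪e i, (CFC.abs K - W * K) (e i)⟫_ℂ := by
              simp
            have h2 : ‖⟪e i, (CFC.abs K - W * K) (e i)⟫_ℂ‖ ≤ ε := by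
              refine (norm_inner_le_norm _ _).trans ?_
              rw [he, one_mul]
              exact (unit_le_opNorm _ _ he.le).trans hWK
            refine (Complex.re_le_norm _).trans ?_
            rw [h1]
            exact (norm_add_le _ _).trans (by gcongr)
        _ = ∑ i ∈ F, ‖⟪e i, W (K (e i))⟫_ℂ‖ + ε * F.card := by
            rw [Finset.sum_add_distrib, Finset.sum_const, nsmul_eq_mul, mul_comm ε]
        _ ≤ C + ε * F.card := by gcongr; exact h W hW s e F
    have hlim : Tendsto (fun ε : ℝ => C + ε * F.card) (𝓝[>] 0) (𝓝 (C + 0 * F.card)) :=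
      ((Continuous.tendsto (by fun_prop) 0).mono_left nhdsWithin_le_nhds)
    rw [zero_mul, add_zero] at hlim
    exact ge_of_tendsto hlim (eventually_nhdsWithin_of_forall fun ε hε => hF ε hε)

lemma IsNuclearExpansion.isTraceClass_sum {κ : Type*} {u v : κ → E} {K : E →L[ℂ] E}
    (h : IsNuclearExpansion u v K) {α : Type*} (s : Finset α) (A B : α → E →L[ℂ] E) :
    IsTraceClass (∑ a ∈ s, A a * K * B a) := by
  refine isTraceClass_of_bound
    (C := ∑ a ∈ s, ‖A a‖ * ‖B a‖ * ∑' k, ‖u k‖ * ‖v k‖) fun W hW t e F => ?_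
  calc ∑ i ∈ F, ‖⟪e i, W ((∑ a ∈ s, A a * K * B a) (e i))⟫_ℂ‖
      ≤ ∑ i ∈ F, ∑ a ∈ s, ‖⟪e i, (W * A a * K * B a) (e i)⟫_ℂ‖ := by
        refine Finset.sum_le_sum fun i _ => ?_
        rw [_root_.sum_apply, map_sum, inner_sum]
        exact norm_sum_le _ _
    _ = ∑ a ∈ s, ∑ i ∈ F, ‖⟪e i, (W * A a * K * B a) (e i)⟫_ℂ‖ := Finset.sum_comm
    _ ≤ _ := by
        refine Finset.sum_le_sum fun a _ => ?_
        have h1 := h.mul_mul (W * A a) (B a)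
        refine (h1.sum_norm_inner_le e.orthonormal F).trans ?_
        rw [← tsum_mul_left]
        refine h1.summable_norm.tsum_le_tsum (fun k => ?_) (h.summable_norm.mul_left _)
        have hWA : ‖W * A a‖ ≤ ‖A a‖ :=
          (norm_mul_le _ _).trans (mul_le_of_le_one_left (norm_nonneg _) hW)
        calc _ ≤ (‖adjoint (B a)‖ * ‖u k‖) * (‖W * A a‖ * ‖v k‖) := by
              gcongr <;> exact le_opNorm _ _
          _ ≤ (‖B a‖ * ‖u k‖) * (‖A a‖ * ‖v k‖) := by
              rw [LinearIsometryEquiv.norm_map]; gcongr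
          _ = _ := by ring

lemma IsNuclearExpansion.isTraceClass_mul_mul {κ : Type*} {u v : κ → E} {K : E →L[ℂ] E}
    (h : IsNuclearExpansion u v K) (A B : E →L[ℂ] E) : IsTraceClass (A * K * B) := by
  simpa using h.isTraceClass_sum {()} (fun _ => A) (fun _ => B)

end TraceClass

end TraceFormula

/-! ### Strong-* convergence and convergence of traces -/

namespace TraceFormula

open ContinuousLinearMap

section StrongStar

variable {E : Type*} [NormedAddCommGroup E] [InnerProductSpace ℂ E] [CompleteSpace E]
variable {α : Type*} {l : Filter α}

/-- Bounded strong-* convergence: the operators `A a` are uniformly bounded, and both `A a` and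
their adjoints converge pointwise along `l`. -/
structure StrongStarTendsto (A : α → E →L[ℂ] E) (l : Filter α) (A' : E →L[ℂ] E) : Prop where
  tendsto_apply : ∀ x, Tendsto (fun a => A a x) l (𝓝 (A' x))
  tendsto_adjoint : ∀ x, Tendsto (fun a => adjoint (A a) x) l (𝓝 (adjoint A' x))
  bounded : ∃ C, ∀ a, ‖A a‖ ≤ C

omit [CompleteSpace E] in
lemma tendsto_apply_of_bounded {A : α → E →L[ℂ] E} {A' : E →L[ℂ] E} {C : ℝ}
    (hC : ∀ a, ‖A a‖ ≤ C) (hA : ∀ x, Tendsto (fun a => A a x) l (𝓝 (A' x))) {y : α → E} {y' : E}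
    (hy : Tendsto y l (𝓝 y')) : Tendsto (fun a => A a (y a)) l (𝓝 (A' y')) := by
  have h1 : Tendsto (fun a => A a (y a - y')) l (𝓝 0) := by
    refine squeeze_zero_norm (a := fun a => C * ‖y a - y'‖) (fun a => ?_) ?_
    · exact (le_opNorm _ _).trans (by gcongr; exact hC a)
    · simpa using ((hy.sub_const y').norm.const_mul C)
  simpa using h1.add (hA y')

namespace StrongStarTendsto

variable {A B : α → E →L[ℂ] E} {A' B' : E →L[ℂ] E}

lemma const (A' : E →L[ℂ] E) : StrongStarTendsto (fun _ : α => A') l A' :=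
  ⟨fun _ => tendsto_const_nhds, fun _ => tendsto_const_nhds, ‖A'‖, fun _ => le_rfl⟩

lemma mul (hA : StrongStarTendsto A l A') (hB : StrongStarTendsto B l B') :
    StrongStarTendsto (fun a => A a * B a) l (A' * B') := by
  obtain ⟨C, hC⟩ := hA.bounded
  obtain ⟨D, hD⟩ := hB.bounded
  refine ⟨fun x => ?_, fun x => ?_, C * D, fun a => ?_⟩
  · exact tendsto_apply_of_bounded hC hA.tendsto_apply (hB.tendsto_apply x)
  · simp only [mul_def, adjoint_comp]
    refine tendsto_apply_of_bounded (A := fun a => adjoint (B a)) (C := D) (fun a => ?_)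
      hB.tendsto_adjoint (hA.tendsto_adjoint x)
    simpa using hD a
  · exact (norm_mul_le _ _).trans
      (mul_le_mul (hC a) (hD a) (norm_nonneg _) ((norm_nonneg _).trans (hC a)))

lemma pow (hA : StrongStarTendsto A l A') (n : ℕ) :
    StrongStarTendsto (fun a => A a ^ n) l (A' ^ n) := by
  induction n with
  | zero => simpa using const (l := l) (1 : E →L[ℂ] E)
  | succ n ih => simpa only [pow_succ] using ih.mul hA

lemma smul (hA : StrongStarTendsto A l A') (c : ℂ) :
    StrongStarTendsto (fun a => c • A a) l (c • A') := by
  have h := (const (l := l) (c • (1 : E →L[ℂ] E))).mul hA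
  simpa using h

lemma sub (hA : StrongStarTendsto A l A') (hB : StrongStarTendsto B l B') :
    StrongStarTendsto (fun a => A a - B a) l (A' - B') := by
  obtain ⟨C, hC⟩ := hA.bounded
  obtain ⟨D, hD⟩ := hB.bounded
  refine ⟨fun x => ?_, fun x => ?_, C + D, fun a => ?_⟩
  · simpa using (hA.tendsto_apply x).sub (hB.tendsto_apply x)
  · simpa using (hA.tendsto_adjoint x).sub (hB.tendsto_adjoint x)
  · exact (norm_sub_le _ _).trans (add_le_add (hC a) (hD a))

/-- Uniformly bounded inverses of a strong-* convergent family converge. -/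
lemma inverse (hA : StrongStarTendsto A l A') {C : ℝ} (hB : ∀ a, ‖B a‖ ≤ C)
    (hBA : ∀ a, B a * A a = 1) (hAB : ∀ a, A a * B a = 1) (hAB' : A' * B' = 1)
    (hBA' : B' * A' = 1) : StrongStarTendsto B l B' := by
  have key (S T : α → E →L[ℂ] E) (S' T' : E →L[ℂ] E)
      (hS : ∀ x, Tendsto (fun a => S a x) l (𝓝 (S' x))) (hT : ∀ a, ‖T a‖ ≤ C)
      (hTS : ∀ a, T a * S a = 1) (hST' : S' * T' = 1) (x : E) :
      Tendsto (fun a => T a x) l (𝓝 (T' x)) := by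
    have h1 (a : α) : T a x = T' x + T a (S' (T' x) - S a (T' x)) := by
      have e1 := DFunLike.congr_fun (hTS a) (T' x)
      have e2 := DFunLike.congr_fun hST' x
      simp only [mul_apply_eq_comp, one_apply_eq_self] at e1 e2
      simp [map_sub, e1, e2]
    have h2 : Tendsto (fun a => T a (S' (T' x) - S a (T' x))) l (𝓝 0) := by
      refine squeeze_zero_norm (a := fun a => C * ‖S' (T' x) - S a (T' x)‖) (fun a => ?_) ?_
      · exact (le_opNorm _ _).trans (by gcongr; exact hT a)
      · simpa using ((hS (T' x)).const_sub (S' (T' x))).norm.const_mul C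
    simp only [h1]
    simpa using h2.const_add (T' x)
  have hadj {S T : E →L[ℂ] E} (h : S * T = 1) : adjoint T * adjoint S = 1 := by
    rw [mul_def, ← adjoint_comp, ← mul_def, h]
    exact star_one (E →L[ℂ] E)
  exact ⟨key A B A' B' hA.tendsto_apply hB hBA hAB',
    key (fun a => adjoint (A a)) (fun a => adjoint (B a)) (adjoint A') (adjoint B')
      hA.tendsto_adjoint (fun a => by simpa using hB a) (fun a => hadj (hAB a)) (hadj hBA'),
    C, hB⟩

end StrongStarTendsto

omit [CompleteSpace E] in
lemma norm_pow_le_of_norm_le {S : E →L[ℂ] E} {r : ℝ} (hS : ‖S‖ ≤ r) (n : ℕ) :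
    ‖S ^ n‖ ≤ r ^ n := by
  rcases Nat.eq_zero_or_pos n with rfl | hn
  · simpa only [pow_zero] using! norm_id_le
  · exact (norm_pow_le' _ hn).trans (by gcongr)

namespace IsNuclearExpansion

variable {κ ι : Type*} {u v : κ → E} {K : E →L[ℂ] E}

lemma norm_trace_mul_mul_le (h : IsNuclearExpansion u v K) (b : HilbertBasis ι ℂ E)
    (A B : E →L[ℂ] E) : ‖trace b (A * K * B)‖ ≤ ‖A‖ * ‖B‖ * ∑' k, ‖u k‖ * ‖v k‖ := by
  have h1 := h.mul_mul A B
  refine (h1.norm_trace_le b).trans ?_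
  rw [← tsum_mul_left]
  refine h1.summable_norm.tsum_le_tsum (fun k => ?_) (h.summable_norm.mul_left _)
  calc _ ≤ (‖adjoint B‖ * ‖u k‖) * (‖A‖ * ‖v k‖) := by gcongr <;> exact le_opNorm _ _
    _ = _ := by rw [LinearIsometryEquiv.norm_map]; ring

/-- The trace of `A K B` is continuous in `A` and `B` for bounded strong-* convergence, by
dominated convergence in the nuclear expansion of `K`. -/
lemma tendsto_trace (h : IsNuclearExpansion u v K) (b : HilbertBasis ι ℂ E)
    {A B : α → E →L[ℂ] E} {A' B' : E →L[ℂ] E} (hA : StrongStarTendsto A l A')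
    (hB : StrongStarTendsto B l B') :
    Tendsto (fun a => trace b (A a * K * B a)) l (𝓝 (trace b (A' * K * B'))) := by
  obtain ⟨C, hC⟩ := hA.bounded
  obtain ⟨D, hD⟩ := hB.bounded
  simp only [(h.mul_mul _ _).trace_eq b]
  refine tendsto_tsum_of_dominated_convergence (bound := fun k => (D * C) * (‖u k‖ * ‖v k‖))
    (h.summable_norm.mul_left _) (fun k => ?_) (Eventually.of_forall fun a k => ?_)
  · exact (hB.tendsto_adjoint (u k)).inner (hA.tendsto_apply (v k))
  · refine (norm_inner_le_norm _ _).trans ?_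
    have hD0 : 0 ≤ D := (norm_nonneg _).trans (hD a)
    calc _ ≤ (‖adjoint (B a)‖ * ‖u k‖) * (‖A a‖ * ‖v k‖) := by gcongr <;> exact le_opNorm _ _
      _ ≤ (D * ‖u k‖) * (C * ‖v k‖) := by
          rw [LinearIsometryEquiv.norm_map]
          gcongr
          exacts [hD a, hC a]
      _ = _ := by ring

/-- The series `∑ Tr (Xⁿ) / n` is continuous along uniformly contractive `X = A K B`. -/
lemma tendsto_tsum_trace_pow (h : IsNuclearExpansion u v K) (b : HilbertBasis ι ℂ E)
    {A B : α → E →L[ℂ] E} {A' B' : E →L[ℂ] E} (hA : StrongStarTendsto A l A')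
    (hB : StrongStarTendsto B l B') {q : ℝ} (hq0 : 0 ≤ q) (hq : q < 1)
    (hX : ∀ a, ‖A a * K * B a‖ ≤ q) :
    Tendsto (fun a => ∑' n : ℕ, trace b ((A a * K * B a) ^ n) / n) l
      (𝓝 (∑' n : ℕ, trace b ((A' * K * B') ^ n) / n)) := by
  obtain ⟨C, hC⟩ := hA.bounded
  obtain ⟨D, hD⟩ := hB.bounded
  have hpow (S T : E →L[ℂ] E) (n : ℕ) : (S * K * T) ^ (n + 1) = S * K * (T * (S * K * T) ^ n) := by
    rw [pow_succ', mul_assoc]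
  have hN : 0 ≤ ∑' k, ‖u k‖ * ‖v k‖ := tsum_nonneg fun k => by positivity
  refine tendsto_tsum_of_dominated_convergence
    (bound := fun n => |C * D * ∑' k, ‖u k‖ * ‖v k‖| * q ^ (n - 1)) ?_ (fun n => ?_)
    (Eventually.of_forall fun a n => ?_)
  · rw [← summable_nat_add_iff 1]
    exact (summable_geometric_of_lt_one hq0 hq).mul_left _
  · cases n with
    | zero => simpa using tendsto_const_nhds
    | succ n =>
      refine Tendsto.div_const ?_ _
      simp only [hpow]
      exact h.tendsto_trace b hA
        (hB.mul (((hA.mul (StrongStarTendsto.const K)).mul hB).pow n))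
  · cases n with
    | zero => simp; positivity
    | succ n =>
      have hC0 : 0 ≤ C := (norm_nonneg _).trans (hC a)
      have hD0 : 0 ≤ D := (norm_nonneg _).trans (hD a)
      have hXn : ‖(A a * K * B a) ^ n‖ ≤ q ^ n := norm_pow_le_of_norm_le (hX a) n
      rw [norm_div, Complex.norm_natCast]
      refine (div_le_self (norm_nonneg _) (by simp)).trans ?_
      rw [hpow, add_tsub_cancel_right]
      refine (h.norm_trace_mul_mul_le b _ _).trans ?_
      calc ‖A a‖ * ‖B a * (A a * K * B a) ^ n‖ * ∑' k, ‖u k‖ * ‖v k‖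
          ≤ C * (D * q ^ n) * ∑' k, ‖u k‖ * ‖v k‖ := by
            gcongr
            · exact hC a
            · exact (norm_mul_le _ _).trans (by gcongr; exact hD a)
        _ = (C * D * ∑' k, ‖u k‖ * ‖v k‖) * q ^ n := by ring
        _ ≤ _ := by gcongr; exact le_abs_self _

end IsNuclearExpansion

/-- Telescoping of a difference of powers, without commutativity. -/
lemma pow_sub_pow_eq_sum {R : Type*} [Ring R] (x y : R) (n : ℕ) :
    x ^ n - y ^ n = ∑ j ∈ Finset.range n, x ^ j * (x - y) * y ^ (n - 1 - j) := by
  induction n with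
  | zero => simp
  | succ n ih =>
    have h : ∑ j ∈ Finset.range n, x ^ j * (x - y) * y ^ (n + 1 - 1 - j) = (x ^ n - y ^ n) * y := by
      rw [ih, Finset.sum_mul]
      refine Finset.sum_congr rfl fun j hj => ?_
      have : n + 1 - 1 - j = n - 1 - j + 1 := by have := Finset.mem_range.mp hj; omega
      rw [this, pow_succ, mul_assoc _ _ y]
    rw [Finset.sum_range_succ, h, add_tsub_cancel_right, tsub_self, pow_zero, mul_one, pow_succ,
      pow_succ]
    noncomm_ring

namespace IsNuclearExpansion

variable {κ ι : Type*} {u v : κ → E} {K : E →L[ℂ] E}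

lemma trace_sum (h : IsNuclearExpansion u v K) (b : HilbertBasis ι ℂ E) {β : Type*}
    (s : Finset β) (A B : β → E →L[ℂ] E) :
    trace b (∑ j ∈ s, A j * K * B j) = ∑ j ∈ s, trace b (A j * K * B j) := by
  have h1 := hasSum_sum (s := s) fun j _ => (h.mul_mul (A j) (B j)).hasSum_trace b
  simp only [← (h.mul_mul _ _).trace_eq b, ← inner_sum, ← _root_.sum_apply] at h1
  exact h1.tsum_eq

omit [CompleteSpace E] in
lemma pow_sub_pow_eq {A B C D : E →L[ℂ] E} (hAB : A - B = C * K * D) (n : ℕ) :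
    A ^ n - B ^ n = ∑ j ∈ Finset.range n, A ^ j * C * K * (D * B ^ (n - 1 - j)) := by
  rw [pow_sub_pow_eq_sum, hAB]
  simp only [mul_assoc]

lemma isTraceClass_pow_sub_pow (h : IsNuclearExpansion u v K) {A B : E →L[ℂ] E}
    (hAB : A - B = K) (n : ℕ) : IsTraceClass (A ^ n - B ^ n) := by
  rw [pow_sub_pow_eq_sum, hAB]
  exact h.isTraceClass_sum _ _ _

lemma norm_trace_pow_sub_pow_le (h : IsNuclearExpansion u v K) (b : HilbertBasis ι ℂ E)
    {A B C D : E →L[ℂ] E} (hAB : A - B = C * K * D) (hC : ‖C‖ ≤ 1) (hD : ‖D‖ ≤ 1) {r : ℝ}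
    (hA : ‖A‖ ≤ r) (hB : ‖B‖ ≤ r) (n : ℕ) :
    ‖trace b (A ^ n - B ^ n)‖ ≤ n * (r ^ (n - 1) * ∑' k, ‖u k‖ * ‖v k‖) := by
  have hN : 0 ≤ ∑' k, ‖u k‖ * ‖v k‖ := tsum_nonneg fun k => by positivity
  have hr : 0 ≤ r := (norm_nonneg _).trans hA
  rw [pow_sub_pow_eq hAB, h.trace_sum b]
  refine (norm_sum_le _ _).trans ?_
  rw [← nsmul_eq_mul]
  nth_rewrite 3 [← Finset.card_range n]
  refine Finset.sum_le_card_nsmul _ _ _ fun j hj => ?_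
  refine (h.norm_trace_mul_mul_le b _ _).trans ?_
  have hj' : j + (n - 1 - j) = n - 1 := by have := Finset.mem_range.mp hj; omega
  rw [show r ^ (n - 1) = r ^ j * r ^ (n - 1 - j) by rw [← pow_add, hj']]
  gcongr
  · refine (norm_mul_le _ _).trans ?_
    calc _ ≤ r ^ j * 1 := by gcongr; exact norm_pow_le_of_norm_le hA j
      _ = _ := mul_one _
  · refine (norm_mul_le _ _).trans ?_
    calc _ ≤ 1 * r ^ (n - 1 - j) := by gcongr; exact norm_pow_le_of_norm_le hB _
      _ = _ := one_mul _

/-- The generating series `∑ wⁿ Tr (Aⁿ - Bⁿ) / n` is continuous along bounded strong-* convergence,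
if `A - B` varies only by contractions applied to a fixed nuclear operator. -/
lemma tendsto_tsum_trace_pow_sub_pow (h : IsNuclearExpansion u v K) (b : HilbertBasis ι ℂ E)
    {A B C D : α → E →L[ℂ] E} {A' B' C' D' : E →L[ℂ] E} (hA : StrongStarTendsto A l A')
    (hB : StrongStarTendsto B l B') (hC : StrongStarTendsto C l C')
    (hD : StrongStarTendsto D l D') (hAB : ∀ a, A a - B a = C a * K * D a)
    (hAB' : A' - B' = C' * K * D') (hC1 : ∀ a, ‖C a‖ ≤ 1) (hD1 : ∀ a, ‖D a‖ ≤ 1) {r : ℝ}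
    (hAr : ∀ a, ‖A a‖ ≤ r) (hBr : ∀ a, ‖B a‖ ≤ r) (hr : 0 ≤ r) {w : ℂ} (hw : ‖w‖ * r < 1) :
    Tendsto (fun a => ∑' n : ℕ, trace b (A a ^ n - B a ^ n) / n * w ^ n) l
      (𝓝 (∑' n : ℕ, trace b (A' ^ n - B' ^ n) / n * w ^ n)) := by
  have hN : 0 ≤ ∑' k, ‖u k‖ * ‖v k‖ := tsum_nonneg fun k => by positivity
  refine tendsto_tsum_of_dominated_convergence
    (bound := fun n => (r ^ (n - 1) * ∑' k, ‖u k‖ * ‖v k‖) * ‖w‖ ^ n) ?_ (fun n => ?_)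
    (Eventually.of_forall fun a n => ?_)
  · rw [← summable_nat_add_iff 1]
    refine ((summable_geometric_of_lt_one (by positivity) hw).mul_left
      ((∑' k, ‖u k‖ * ‖v k‖) * ‖w‖)).congr fun n => ?_
    rw [add_tsub_cancel_right, mul_pow, pow_succ]
    ring
  · refine Tendsto.mul_const _ (Tendsto.div_const ?_ _)
    simp only [pow_sub_pow_eq (hAB _), pow_sub_pow_eq hAB', h.trace_sum b]
    exact tendsto_finsetSum _ fun j _ =>
      h.tendsto_trace b ((hA.pow j).mul hC) (hD.mul (hB.pow _))
  · rw [norm_mul, norm_div, Complex.norm_natCast, norm_pow]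
    gcongr
    refine div_le_of_le_mul₀ (by positivity) (by positivity) ?_
    rw [mul_comm]
    exact h.norm_trace_pow_sub_pow_le b (hAB a) (hC1 a) (hD1 a) (hAr a) (hBr a) n

end IsNuclearExpansion

end StrongStar

end TraceFormula

/-! ### Finite sections -/

namespace TraceFormula

open ContinuousLinearMap InnerProductSpace

section FiniteSection

variable {E : Type*} [NormedAddCommGroup E] [InnerProductSpace ℂ E]
variable {ι : Type*} (b : HilbertBasis ι ℂ E) (F : Finset ι)

/-- The orthogonal projection onto the span of the basis vectors `b i`, `i ∈ F`. -/
noncomputable def basisProj : E →L[ℂ] E :=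
  ∑ i ∈ F, rankOne ℂ (b i) (b i)

lemma basisProj_apply (x : E) : basisProj b F x = ∑ i ∈ F, ⟪b i, x⟫_ℂ • b i := by
  simp [basisProj]

lemma basisProj_apply_of_mem {i : ι} (hi : i ∈ F) : basisProj b F (b i) = b i := by
  classical
  simp [basisProj_apply, orthonormal_iff_ite.mp b.orthonormal, hi]

lemma basisProj_apply_of_notMem {i : ι} (hi : i ∉ F) : basisProj b F (b i) = 0 := by
  classical
  simp [basisProj_apply, orthonormal_iff_ite.mp b.orthonormal, hi]

lemma basisProj_mul_self : basisProj b F * basisProj b F = basisProj b F := by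
  ext x
  rw [mul_apply_eq_comp, basisProj_apply b F x, map_sum]
  exact Finset.sum_congr rfl fun i hi => by rw [map_smul, basisProj_apply_of_mem b F hi]

lemma inner_basisProj_left (x y : E) : ⟪basisProj b F x, y⟫_ℂ = ⟪x, basisProj b F y⟫_ℂ := by
  simp only [basisProj_apply, sum_inner, inner_sum, inner_smul_left, inner_smul_right,
    inner_conj_symm]
  exact Finset.sum_congr rfl fun i _ => mul_comm _ _

lemma norm_basisProj_le : ‖basisProj b F‖ ≤ 1 := by
  refine opNorm_le_bound _ zero_le_one fun x => ?_
  have h1 : ‖basisProj b F x‖ ^ 2 ≤ ‖x‖ * ‖basisProj b F x‖ := by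
    rw [norm_sq_eq_re_inner (𝕜 := ℂ), inner_basisProj_left, ← mul_apply_eq_comp,
      basisProj_mul_self]
    exact re_inner_le_norm _ _
  nlinarith [norm_nonneg x, norm_nonneg (basisProj b F x)]

lemma strongStarTendsto_basisProj [CompleteSpace E] :
    StrongStarTendsto (basisProj b) atTop (1 : E →L[ℂ] E) := by
  have hadj (F : Finset ι) : adjoint (basisProj b F) = basisProj b F :=
    ((eq_adjoint_iff _ _).mpr (inner_basisProj_left b F)).symm
  have h (x : E) : Tendsto (fun F => basisProj b F x) atTop (𝓝 x) := by
    simpa only [basisProj_apply, ← b.repr_apply_apply] using! b.hasSum_repr x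
  refine ⟨h, fun x => ?_, 1, norm_basisProj_le b⟩
  have h1 : adjoint (1 : E →L[ℂ] E) = 1 := star_one (E →L[ℂ] E)
  simpa only [hadj, h1] using! h x

variable {F}

lemma finiteSection_mul_basisProj_mul (A B : E →L[ℂ] E) :
    finiteSection b (A * basisProj b F * B) F = finiteSection b A F * finiteSection b B F := by
  ext i j
  simp only [finiteSection, Matrix.mul_apply, Matrix.of_apply, mul_apply_eq_comp, basisProj_apply,
    map_sum, map_smul, inner_sum, inner_smul_right]
  rw [← Finset.sum_coe_sort F]
  exact Finset.sum_congr rfl fun k _ => mul_comm _ _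

lemma finiteSection_basisProj_mul (A : E →L[ℂ] E) :
    finiteSection b (basisProj b F * A) F = finiteSection b A F := by
  ext i j
  simp [finiteSection, ← inner_basisProj_left, basisProj_apply_of_mem b F i.2]

lemma finiteSection_mul_basisProj (A : E →L[ℂ] E) :
    finiteSection b (A * basisProj b F) F = finiteSection b A F := by
  ext i j
  simp [finiteSection, basisProj_apply_of_mem b F j.2]

lemma finiteSection_one [DecidableEq F] : finiteSection b (1 : E →L[ℂ] E) F = 1 := by
  classical
  ext i j
  rw [Matrix.one_apply, finiteSection, Matrix.of_apply, one_apply_eq_self,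
    orthonormal_iff_ite.mp b.orthonormal]
  simp only [Subtype.ext_iff]

lemma finiteSection_sub (A B : E →L[ℂ] E) :
    finiteSection b (A - B) F = finiteSection b A F - finiteSection b B F := by
  ext i j
  simp [finiteSection]

lemma finiteSection_smul (c : ℂ) (A : E →L[ℂ] E) :
    finiteSection b (c • A) F = c • finiteSection b A F := by
  ext i j
  simp [finiteSection]

lemma finiteSection_pow [DecidableEq F] {X : E →L[ℂ] E} (hX : X * basisProj b F = X) (n : ℕ) :
    finiteSection b X F ^ n = finiteSection b (X ^ n) F := by
  induction n with
  | zero => simp [finiteSection_one]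
  | succ n ih =>
    rw [pow_succ', ih, ← finiteSection_mul_basisProj_mul, hX, pow_succ']

lemma trace_finiteSection {X : E →L[ℂ] E} (hX : X * basisProj b F = X) [CompleteSpace E] :
    (finiteSection b X F).trace = trace b X := by
  rw [trace, tsum_eq_sum (s := F), ← Finset.sum_coe_sort F]
  · rfl
  · intro i hi
    rw [← hX, mul_apply_eq_comp, basisProj_apply_of_notMem b F hi, map_zero, inner_zero_right]

lemma finiteSection_mul_eq_one [DecidableEq F] {S R : E →L[ℂ] E}
    (hS : S * basisProj b F = basisProj b F * S) (h : S * R = 1) :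
    finiteSection b S F * finiteSection b R F = 1 := by
  rw [← finiteSection_mul_basisProj_mul, hS, mul_assoc, h, finiteSection_basisProj_mul,
    finiteSection_one]

/-- The eigenvalues of a compression are bounded by the operator norm. -/
lemma norm_le_of_mem_roots_finiteSection [DecidableEq F] [CompleteSpace E] {X : E →L[ℂ] E}
    (hX : X * basisProj b F = X) (hX' : basisProj b F * X = X) {μ : ℂ}
    (hμ : μ ∈ (finiteSection b X F).charpoly.roots) : ‖μ‖ ≤ ‖X‖ := by
  by_contra! hlt
  have hunit : IsUnit (algebraMap ℂ (E →L[ℂ] E) μ - X) := by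
    refine spectrum.mem_resolventSet_of_norm_lt_mul ?_
    refine lt_of_le_of_lt ?_ hlt
    exact mul_le_of_le_one_right (norm_nonneg _) norm_id_le
  obtain ⟨R, hR⟩ := hunit.exists_right_inv
  have h1 := finiteSection_mul_eq_one b (F := F)
    (S := algebraMap ℂ (E →L[ℂ] E) μ - X) (by
      rw [sub_mul, mul_sub, hX, hX', Algebra.commutes]) hR
  have h2 := Matrix.mem_spectrum_of_isRoot_charpoly (Polynomial.isRoot_of_mem_roots hμ)
  refine h2 ?_
  have h3 : finiteSection b (algebraMap ℂ (E →L[ℂ] E) μ - X) F =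
      algebraMap ℂ (Matrix F F ℂ) μ - finiteSection b X F := by
    rw [finiteSection_sub, Algebra.algebraMap_eq_smul_one, Algebra.algebraMap_eq_smul_one,
      finiteSection_smul, finiteSection_one]
  change IsUnit _
  rw [← h3]
  exact IsUnit.of_mul_eq_one _ h1

lemma summable_and_det_one_sub_finiteSection [DecidableEq F] [CompleteSpace E] {X : E →L[ℂ] E}
    (hX : X * basisProj b F = X) (hX' : basisProj b F * X = X) (hn : ‖X‖ < 1) :
    Summable (fun n : ℕ => (finiteSection b (X ^ n) F).trace / n) ∧
    (1 - finiteSection b X F).det =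
      Complex.exp (-∑' n : ℕ, (finiteSection b (X ^ n) F).trace / n) := by
  have h := Matrix.summable_and_det_one_sub_eq_exp (finiteSection b X F) fun μ hμ =>
    (norm_le_of_mem_roots_finiteSection b hX hX' hμ).trans_lt hn
  simpa only [finiteSection_pow b hX] using h

lemma trace_finiteSection_pow_div [CompleteSpace E] {X : E →L[ℂ] E}
    (hX : X * basisProj b F = X) (n : ℕ) :
    (finiteSection b (X ^ n) F).trace / n = trace b (X ^ n) / n := by
  cases n with
  | zero => simp
  | succ n => rw [trace_finiteSection b (by rw [pow_succ, mul_assoc, hX])]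

lemma det_one_sub_finiteSection [DecidableEq F] [CompleteSpace E] {X : E →L[ℂ] E}
    (hX : X * basisProj b F = X) (hX' : basisProj b F * X = X) (hn : ‖X‖ < 1) :
    (1 - finiteSection b X F).det = Complex.exp (-∑' n : ℕ, trace b (X ^ n) / n) := by
  rw [(summable_and_det_one_sub_finiteSection b hX hX' hn).2]
  simp only [trace_finiteSection_pow_div b hX]

/-- The logarithm of a quotient of two characteristic determinants of compressions. -/
lemma det_one_sub_smul_finiteSection_div [DecidableEq F] [CompleteSpace E] {A B : E →L[ℂ] E}
    (hA : A * basisProj b F = A) (hA' : basisProj b F * A = A) (hB : B * basisProj b F = B)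
    (hB' : basisProj b F * B = B) {w : ℂ} (hAn : ‖w • A‖ < 1) (hBn : ‖w • B‖ < 1) :
    (1 - w • finiteSection b A F).det / (1 - w • finiteSection b B F).det =
      Complex.exp (-∑' n : ℕ, trace b (A ^ n - B ^ n) / n * w ^ n) := by
  obtain ⟨hs, hd⟩ := summable_and_det_one_sub_finiteSection b (F := F) (X := w • A)
    (by rw [smul_mul_assoc, hA]) (by rw [mul_smul_comm, hA']) hAn
  obtain ⟨hs', hd'⟩ := summable_and_det_one_sub_finiteSection b (F := F) (X := w • B)
    (by rw [smul_mul_assoc, hB]) (by rw [mul_smul_comm, hB']) hBn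
  rw [← finiteSection_smul, ← finiteSection_smul, hd, hd', ← Complex.exp_sub, neg_sub_neg,
    ← hs'.tsum_sub hs, ← tsum_neg]
  congr 1
  refine tsum_congr fun n => ?_
  cases n with
  | zero => simp
  | succ n =>
    rw [← trace_finiteSection b (X := A ^ (n + 1) - B ^ (n + 1))
      (by rw [sub_mul, pow_succ, pow_succ, mul_assoc, hA, mul_assoc, hB]), smul_pow, smul_pow,
      finiteSection_sub, finiteSection_smul, finiteSection_smul, Matrix.trace_sub,
      Matrix.trace_smul, Matrix.trace_smul, smul_eq_mul, smul_eq_mul]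
    ring

end FiniteSection

end TraceFormula

/-! ### The perturbation determinant near infinity -/

namespace TraceFormula

open ContinuousLinearMap

section Perturbation

variable {E : Type*} [NormedAddCommGroup E] [InnerProductSpace ℂ E] [CompleteSpace E]

lemma inverse_one_sub_smul {T : E →L[ℂ] E} {w : ℂ} (h : ‖w‖ * ‖T‖ ≤ 1 / 2) :
    Ring.inverse (1 - w • T) * (1 - w • T) = 1 ∧ (1 - w • T) * Ring.inverse (1 - w • T) = 1 ∧
      ‖Ring.inverse (1 - w • T)‖ ≤ 2 := by
  have hn : ‖w • T‖ ≤ 1 / 2 := by rwa [norm_smul]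
  have hu : IsUnit (1 - w • T) := isUnit_one_sub_of_norm_lt_one (by linarith)
  have h1 := Ring.mul_inverse_cancel _ hu
  refine ⟨Ring.inverse_mul_cancel _ hu, h1, ?_⟩
  set G := Ring.inverse (1 - w • T)
  have h2 : G = 1 + w • T * G := by
    rw [sub_mul, one_mul, sub_eq_iff_eq_add] at h1
    exact h1
  have h3 : ‖G‖ ≤ 1 + 1 / 2 * ‖G‖ := by
    calc ‖G‖ = ‖1 + w • T * G‖ := by rw [← h2]
      _ ≤ ‖(1 : E →L[ℂ] E)‖ + ‖w • T‖ * ‖G‖ :=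
        (norm_add_le _ _).trans (by gcongr; exact norm_mul_le _ _)
      _ ≤ 1 + 1 / 2 * ‖G‖ := by
        gcongr
        exact norm_id_le
  linarith

omit [CompleteSpace E] in
lemma sub_smul_one_eq {z : ℂ} (hz : z ≠ 0) (T : E →L[ℂ] E) :
    T - z • (1 : E →L[ℂ] E) = (-z) • (1 - z⁻¹ • T) := by
  rw [smul_sub, smul_smul, neg_mul, mul_inv_cancel₀ hz]
  simp only [neg_smul, one_smul]
  abel

lemma mem_resolventSet_of_norm_inv_mul_le {T : E →L[ℂ] E} {z : ℂ} (hz : z ≠ 0)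
    (h : ‖z⁻¹‖ * ‖T‖ ≤ 1 / 2) : z ∈ resolventSet ℂ T := by
  have hu : IsUnit (1 - z⁻¹ • T) :=
    isUnit_one_sub_of_norm_lt_one (by rw [norm_smul]; linarith)
  have h1 : algebraMap ℂ (E →L[ℂ] E) z - T = (Units.mk0 z hz) • (1 - z⁻¹ • T) := by
    rw [← neg_sub, Algebra.algebraMap_eq_smul_one, sub_smul_one_eq hz, Units.smul_def, neg_smul,
      neg_neg, Units.val_mk0]
  change IsUnit _
  rw [h1]
  exact hu.smul _

lemma freeResolvent_eq {T : E →L[ℂ] E} {z : ℂ} (hz : z ≠ 0) (h : ‖z⁻¹‖ * ‖T‖ ≤ 1 / 2) :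
    freeResolvent T z = (-z⁻¹) • Ring.inverse (1 - z⁻¹ • T) := by
  obtain ⟨h1, h2, -⟩ := inverse_one_sub_smul h
  have h3 : (-z) • (1 - z⁻¹ • T) * ((-z⁻¹) • Ring.inverse (1 - z⁻¹ • T)) = 1 := by
    rw [smul_mul_smul_comm, h2, neg_mul_neg, mul_inv_cancel₀ hz, one_smul]
  have h4 : (-z⁻¹) • Ring.inverse (1 - z⁻¹ • T) * ((-z) • (1 - z⁻¹ • T)) = 1 := by
    rw [smul_mul_smul_comm, h1, neg_mul_neg, inv_mul_cancel₀ hz, one_smul]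
  rw [freeResolvent, sub_smul_one_eq hz]
  exact Ring.inverse_unit ⟨_, _, h3, h4⟩

variable {κ ι : Type*} {u v : κ → E} {V : E →L[ℂ] E}

lemma norm_smul_mul_mul_le {w : ℂ} (hV : ‖w‖ * ‖V‖ ≤ 1 / 4) {P C : E →L[ℂ] E} (hP : ‖P‖ ≤ 1)
    (hC : ‖C‖ ≤ 2) : ‖w • P * V * C‖ ≤ 1 / 2 := by
  calc ‖w • P * V * C‖ ≤ ‖w • P‖ * ‖V‖ * ‖C‖ :=
        (norm_mul_le _ _).trans (by gcongr; exact norm_mul_le _ _)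
    _ ≤ (‖w‖ * 1) * ‖V‖ * 2 := by rw [norm_smul]; gcongr
    _ ≤ 1 / 2 := by linarith

omit [CompleteSpace E] in
lemma basisProj_mul_basisProj_mul (b : HilbertBasis ι ℂ E) (F : Finset ι) (Y : E →L[ℂ] E) :
    basisProj b F * (basisProj b F * Y) = basisProj b F * Y := by
  rw [← mul_assoc, basisProj_mul_self]

omit [CompleteSpace E] in
lemma one_sub_smul_compression_mul_basisProj (b : HilbertBasis ι ℂ E) (F : Finset ι)
    (A : E →L[ℂ] E) (w : ℂ) :
    (1 - w • (basisProj b F * A * basisProj b F)) * basisProj b F =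
      basisProj b F * (1 - w • (basisProj b F * A * basisProj b F)) := by
  simp only [sub_mul, mul_sub, one_mul, mul_one, smul_mul_assoc, mul_smul_comm, mul_assoc,
    basisProj_mul_self, basisProj_mul_basisProj_mul]

omit [CompleteSpace E] in
/-- If `R` is inverse to `1 - w P H₀ P`, then the finite section of `1 - w P V P R` is the product of
the finite section of `1 - w (H₀ + V)` and the inverse of that of `1 - w H₀`. -/
lemma det_one_sub_smul_mul_mul_eq_div (b : HilbertBasis ι ℂ E) {F : Finset ι} [DecidableEq F]
    (H₀ V : E →L[ℂ] E) (w : ℂ) {R : E →L[ℂ] E}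
    (hR : (1 - w • (basisProj b F * H₀ * basisProj b F)) * R = 1) :
    (1 - finiteSection b (w • basisProj b F * V * (basisProj b F * R)) F).det =
      (1 - w • finiteSection b (H₀ + V) F).det / (1 - w • finiteSection b H₀ F).det := by
  have hinv : (1 - w • finiteSection b H₀ F) * finiteSection b R F = 1 := by
    have h1 := finiteSection_mul_eq_one b (one_sub_smul_compression_mul_basisProj b F H₀ w) hR
    rwa [finiteSection_sub, finiteSection_one, finiteSection_smul,
      finiteSection_mul_basisProj, finiteSection_basisProj_mul] at h1
  have hX : finiteSection b (w • basisProj b F * V * (basisProj b F * R)) F =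
      w • (finiteSection b V F * finiteSection b R F) := by
    have h1 : w • basisProj b F * V * (basisProj b F * R) =
        basisProj b F * (w • (V * basisProj b F * R)) := by
      simp only [smul_mul_assoc, mul_smul_comm, mul_assoc]
    rw [h1, finiteSection_basisProj_mul, finiteSection_smul, finiteSection_mul_basisProj_mul]
  have hadd : finiteSection b (H₀ + V) F = finiteSection b H₀ F + finiteSection b V F := by
    ext i j
    simp [finiteSection]
  rw [hX, hadd]
  set M := finiteSection b H₀ F
  set N := finiteSection b V F
  set Q := finiteSection b R F
  have hdet : (1 - w • M).det ≠ 0 := by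
    intro h0
    have h1 := congrArg Matrix.det hinv
    rw [Matrix.det_mul, h0, zero_mul, Matrix.det_one] at h1
    exact zero_ne_one h1
  rw [eq_div_iff hdet, ← Matrix.det_mul, sub_mul, one_mul, smul_mul_assoc, mul_assoc,
    mul_eq_one_comm.mp hinv, mul_one, smul_add, sub_sub]

/-- For small `w`, both the finite sections of `1 - w V (1 - w H₀)⁻¹` and the quotients of
characteristic determinants of the compressions of `H₀ + V` and `H₀` are determinants
`det (1 - X)`, with `X` strong-* convergent to `w V (1 - w H₀)⁻¹`. Hence they have the same
limit, which the quotients identify. -/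
lemma tendsto_det_one_sub_finiteSection (h : IsNuclearExpansion u v V) (b : HilbertBasis ι ℂ E)
    (H₀ : E →L[ℂ] E) {w : ℂ} {r : ℝ} (hH₀ : ‖H₀‖ ≤ r) (hH : ‖H₀ + V‖ ≤ r)
    (hr : ‖w‖ * r ≤ 1 / 2) (hV : ‖w‖ * ‖V‖ ≤ 1 / 4)
    [∀ F : Finset ι, DecidableEq F] :
    Tendsto (fun F : Finset ι =>
        (1 - finiteSection b (w • (V * Ring.inverse (1 - w • H₀))) F).det) atTop
      (𝓝 (Complex.exp (-∑' n : ℕ, trace b ((H₀ + V) ^ n - H₀ ^ n) / n * w ^ n))) := by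
  have hr0 : 0 ≤ r := (norm_nonneg _).trans hH₀
  set P := basisProj b with hPdef
  have hP : StrongStarTendsto P atTop 1 := strongStarTendsto_basisProj b
  have hP1 (F) : ‖P F‖ ≤ 1 := norm_basisProj_le b F
  have hPP (F) : P F * P F = P F := basisProj_mul_self b F
  have hPPl (F) (Y : E →L[ℂ] E) : P F * (P F * Y) = P F * Y := basisProj_mul_basisProj_mul b F Y
  have hcomp {A : E →L[ℂ] E} (hA : ‖A‖ ≤ r) (F : Finset ι) : ‖P F * A * P F‖ ≤ r := by
    calc ‖P F * A * P F‖ ≤ ‖P F‖ * ‖A‖ * ‖P F‖ :=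
          (norm_mul_le _ _).trans (by gcongr; exact norm_mul_le _ _)
      _ ≤ 1 * r * 1 := by gcongr <;> exact hP1 F
      _ = r := by ring
  have hsmul {A : E →L[ℂ] E} (hA : ‖A‖ ≤ r) : ‖w‖ * ‖A‖ ≤ 1 / 2 := le_trans (by gcongr) hr
  have hsm {A : E →L[ℂ] E} (hA : ‖A‖ ≤ r) : ‖w • A‖ < 1 := by
    rw [norm_smul]
    linarith [hsmul hA]
  have hcT (A : E →L[ℂ] E) : StrongStarTendsto (fun F => P F * A * P F) atTop A := by
    simpa using (hP.mul (.const A)).mul hP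
  set A : Finset ι → E →L[ℂ] E := fun F => P F * H₀ * P F with hAdef
  set G := Ring.inverse (1 - w • H₀) with hG
  obtain ⟨hG1, hG2, hGn⟩ := inverse_one_sub_smul (hsmul hH₀)
  set GF : Finset ι → E →L[ℂ] E := fun F => Ring.inverse (1 - w • A F) with hGF
  have hGF' (F) := inverse_one_sub_smul (hsmul (hcomp hH₀ F))
  have hGT : StrongStarTendsto GF atTop G :=
    ((StrongStarTendsto.const 1).sub ((hcT H₀).smul w)).inverse (C := 2) (fun F => (hGF' F).2.2)
      (fun F => (hGF' F).1) (fun F => (hGF' F).2.1) hG2 hG1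
  have hGP2 (F) : ‖G * P F‖ ≤ 2 := by
    calc ‖G * P F‖ ≤ ‖G‖ * ‖P F‖ := norm_mul_le _ _
      _ ≤ 2 * 1 := by gcongr; exact hP1 F
      _ = 2 := by norm_num
  have hPG2 (F) : ‖P F * GF F‖ ≤ 2 := by
    calc ‖P F * GF F‖ ≤ ‖P F‖ * ‖GF F‖ := norm_mul_le _ _
      _ ≤ 1 * 2 := by gcongr; exacts [hP1 F, (hGF' F).2.2]
      _ = 2 := by norm_num
  -- The finite sections of `w V G`.
  have lim1 := h.tendsto_tsum_trace_pow b (hP.smul w) ((StrongStarTendsto.const G).mul hP)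
    (q := 1 / 2) (by norm_num) (by norm_num) (fun F => norm_smul_mul_mul_le hV (hP1 F) (hGP2 F))
  have eq1 (F : Finset ι) : (1 - finiteSection b (w • (V * G)) F).det =
      Complex.exp (-∑' n : ℕ, trace b ((w • P F * V * (G * P F)) ^ n) / n) := by
    have hnorm : ‖w • P F * V * (G * P F)‖ ≤ 1 / 2 := norm_smul_mul_mul_le hV (hP1 F) (hGP2 F)
    rw [← det_one_sub_finiteSection b (F := F) (by simp only [mul_assoc, ← hPdef, hPP])
      (by simp only [smul_mul_assoc, mul_smul_comm, ← hPdef, mul_assoc, hPPl])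
      (by linarith)]
    rw [show w • P F * V * (G * P F) = P F * (w • (V * G)) * P F by
      simp only [smul_mul_assoc, mul_smul_comm, mul_assoc], finiteSection_mul_basisProj,
      finiteSection_basisProj_mul]
  -- The quotients of determinants.
  have lim2 := h.tendsto_tsum_trace_pow b (hP.smul w) (hP.mul hGT)
    (q := 1 / 2) (by norm_num) (by norm_num) (fun F => norm_smul_mul_mul_le hV (hP1 F) (hPG2 F))
  have lim3 := h.tendsto_tsum_trace_pow_sub_pow b (hcT (H₀ + V)) (hcT H₀) hP hP
    (fun F => by noncomm_ring) (by noncomm_ring) hP1 hP1 (hcomp hH) (hcomp hH₀) hr0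
    (w := w) (by linarith)
  have eq2 (F : Finset ι) :
      Complex.exp (-∑' n : ℕ, trace b ((w • P F * V * (P F * GF F)) ^ n) / n) =
      Complex.exp (-∑' n : ℕ, trace b ((P F * (H₀ + V) * P F) ^ n - (P F * H₀ * P F) ^ n) / n *
        w ^ n) := by
    have hcomm : (1 - w • A F) * P F = P F * (1 - w • A F) :=
      one_sub_smul_compression_mul_basisProj b F H₀ w
    have hGP : GF F * P F = P F * GF F := by
      calc GF F * P F = GF F * (P F * ((1 - w • A F) * GF F)) := by rw [(hGF' F).2.1, mul_one]
        _ = GF F * ((1 - w • A F) * P F) * GF F := by rw [hcomm]; simp only [mul_assoc]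
        _ = P F * GF F := by rw [← mul_assoc (GF F), (hGF' F).1, one_mul]
    have hnorm : ‖w • P F * V * (P F * GF F)‖ ≤ 1 / 2 := norm_smul_mul_mul_le hV (hP1 F) (hPG2 F)
    rw [← det_one_sub_finiteSection b (F := F) (by simp only [mul_assoc, ← hPdef, hGP, hPPl])
      (by simp only [smul_mul_assoc, mul_smul_comm, ← hPdef, mul_assoc, hPPl])
      (by linarith),
      ← det_one_sub_smul_finiteSection_div b (F := F) (A := P F * (H₀ + V) * P F)
      (B := P F * H₀ * P F)
      (by simp only [mul_assoc, ← hPdef, hPP]) (by simp only [← hPdef, mul_assoc, hPPl])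
      (by simp only [mul_assoc, ← hPdef, hPP]) (by simp only [← hPdef, mul_assoc, hPPl])
      (hsm (hcomp hH F)) (hsm (hcomp hH₀ F))]
    rw [det_one_sub_smul_mul_mul_eq_div b H₀ V w (hGF' F).2.1, finiteSection_mul_basisProj,
      finiteSection_basisProj_mul, finiteSection_mul_basisProj, finiteSection_basisProj_mul]
  have e2 := (Complex.continuous_exp.tendsto _).comp lim2.neg
  have e3 := (Complex.continuous_exp.tendsto _).comp lim3.neg
  have e1 := (Complex.continuous_exp.tendsto _).comp lim1.neg
  have hlim : Complex.exp (-∑' n : ℕ, trace b ((w • (1 : E →L[ℂ] E) * V * (1 * G)) ^ n) / n) =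
      Complex.exp (-∑' n : ℕ, trace b ((H₀ + V) ^ n - H₀ ^ n) / n * w ^ n) :=
    tendsto_nhds_unique (e2.congr eq2) e3
  rw [← hlim, one_mul]
  rw [mul_one] at e1
  exact e1.congr fun F => (eq1 F).symm

/-- `D(z) = exp (-∑ F_n z⁻ⁿ / n)` for large `z`. -/
lemma perturbationDet_eq_exp (h : IsNuclearExpansion u v V) (b : HilbertBasis ι ℂ E)
    (H₀ : E →L[ℂ] E) {z : ℂ} (hz : z ≠ 0) {r : ℝ} (hH₀ : ‖H₀‖ ≤ r) (hH : ‖H₀ + V‖ ≤ r)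
    (hr : ‖z⁻¹‖ * r ≤ 1 / 2) (hV : ‖z⁻¹‖ * ‖V‖ ≤ 1 / 4) :
    perturbationDet b H₀ V z =
      Complex.exp (-∑' n : ℕ, momentCoeff b H₀ V n / n * z⁻¹ ^ n) := by
  classical
  have h1 := tendsto_det_one_sub_finiteSection h b H₀ hH₀ hH hr hV
  refine Tendsto.limUnder_eq (h1.congr fun F => ?_)
  rw [freeResolvent_eq hz (le_trans (by gcongr) hr), mul_smul_comm, neg_smul,
    show -(z⁻¹ • (V * Ring.inverse (1 - z⁻¹ • H₀))) =
      (-1 : ℂ) • (z⁻¹ • (V * Ring.inverse (1 - z⁻¹ • H₀))) by simp,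
    finiteSection_smul b (-1), neg_one_smul, ← sub_eq_add_neg]

end Perturbation

end TraceFormula

/-! ### The expansion of the logarithm -/

namespace TraceFormula

section Expansion

variable {E : Type*} [NormedAddCommGroup E] [InnerProductSpace ℂ E] [CompleteSpace E]
variable {κ ι : Type*} {u v : κ → E} {V : E →L[ℂ] E}

lemma norm_momentCoeff_term_le (h : IsNuclearExpansion u v V) (b : HilbertBasis ι ℂ E)
    (H₀ : E →L[ℂ] E) {r : ℝ} (hH₀ : ‖H₀‖ ≤ r) (hH : ‖H₀ + V‖ ≤ r) (n : ℕ) (w : ℂ) :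
    ‖momentCoeff b H₀ V (n + 1) / ((n + 1 : ℕ) : ℂ) * w ^ (n + 1)‖ ≤
      (∑' k, ‖u k‖ * ‖v k‖) * ‖w‖ * (‖w‖ * r) ^ n := by
  have h1 := h.norm_trace_pow_sub_pow_le b (A := H₀ + V) (B := H₀) (C := 1) (D := 1) (by simp)
    ContinuousLinearMap.norm_id_le ContinuousLinearMap.norm_id_le hH hH₀ (n + 1)
  rw [add_tsub_cancel_right] at h1
  rw [norm_mul, norm_div, Complex.norm_natCast, norm_pow, momentCoeff]
  calc _ ≤ r ^ n * (∑' k, ‖u k‖ * ‖v k‖) * ‖w‖ ^ (n + 1) := by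
        gcongr
        rw [div_le_iff₀ (by positivity), mul_comm (r ^ n * _)]
        exact h1
    _ = _ := by rw [mul_pow, pow_succ]; ring

omit [CompleteSpace E] in
lemma tsum_momentCoeff_eq (b : HilbertBasis ι ℂ E) (H₀ : E →L[ℂ] E) {w : ℂ}
    (hs : Summable fun n : ℕ => momentCoeff b H₀ V (n + 1) / ((n + 1 : ℕ) : ℂ) * w ^ (n + 1)) :
    ∑' n : ℕ, momentCoeff b H₀ V n / n * w ^ n =
      ∑' n : ℕ, momentCoeff b H₀ V (n + 1) / ((n + 1 : ℕ) : ℂ) * w ^ (n + 1) := by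
  rw [((summable_nat_add_iff (f := fun n : ℕ => momentCoeff b H₀ V n / n * w ^ n) 1).mp
    hs).tsum_eq_zero_add]
  simp

lemma exists_log_perturbationDet_expansion (h : IsNuclearExpansion u v V)
    (b : HilbertBasis ι ℂ E) (H₀ : E →L[ℂ] E) :
    ∃ r₀ : ℝ, 0 < r₀ ∧
      (∀ z : ℂ, r₀ ≤ ‖z‖ → z ∈ resolventSet ℂ H₀ ∧
        perturbationDet b H₀ V z ∈ Complex.slitPlane) ∧
      TendstoUniformlyOn
        (fun (N : ℕ) (z : ℂ) =>
          -∑ n ∈ Finset.Icc 1 N, momentCoeff b H₀ V n / (n : ℂ) * (1 / z) ^ n)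
        (fun z : ℂ => Complex.log (perturbationDet b H₀ V z)) atTop {z : ℂ | r₀ ≤ ‖z‖} := by
  set N := ∑' k, ‖u k‖ * ‖v k‖ with hNdef
  have hN : 0 ≤ N := tsum_nonneg fun k => by positivity
  set r := ‖H₀‖ + ‖V‖ with hrdef
  have hr : 0 ≤ r := by positivity
  have hH₀ : ‖H₀‖ ≤ r := le_add_of_nonneg_right (norm_nonneg _)
  have hH : ‖H₀ + V‖ ≤ r := norm_add_le _ _
  -- `4 r` makes the Neumann series converge, and `2 N` keeps `|log D|` below `1 < π`.
  set r₀ := 4 * r + 2 * N + 1 with hr₀def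
  have hr₀ : 0 < r₀ := by positivity
  have hinv {z : ℂ} (hz : r₀ ≤ ‖z‖) : z ≠ 0 ∧ ‖z⁻¹‖ ≤ r₀⁻¹ := by
    refine ⟨norm_pos_iff.mp (hr₀.trans_le hz), ?_⟩
    rw [norm_inv]
    exact inv_anti₀ hr₀ hz
  have hr4 : r₀⁻¹ * r ≤ 1 / 4 := by
    rw [inv_mul_le_iff₀ hr₀]
    linarith
  have hN2 : N * r₀⁻¹ ≤ 1 / 2 := by
    rw [← div_eq_mul_inv, div_le_iff₀ hr₀]
    linarith
  have hwr {z : ℂ} (hz : r₀ ≤ ‖z‖) : ‖z⁻¹‖ * r ≤ 1 / 4 :=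
    (mul_le_mul_of_nonneg_right (hinv hz).2 hr).trans hr4
  set f : ℕ → ℂ → ℂ := fun n z =>
    momentCoeff b H₀ V (n + 1) / ((n + 1 : ℕ) : ℂ) * z⁻¹ ^ (n + 1) with hf
  have hbound (n : ℕ) (z : ℂ) (hz : r₀ ≤ ‖z‖) : ‖f n z‖ ≤ 1 / 2 * (1 / 2) ^ n := by
    refine (norm_momentCoeff_term_le h b H₀ hH₀ hH n z⁻¹).trans ?_
    have h1 : N * ‖z⁻¹‖ ≤ 1 / 2 := (mul_le_mul_of_nonneg_left (hinv hz).2 hN).trans hN2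
    have h2 : ‖z⁻¹‖ * r ≤ 1 / 2 := (hwr hz).trans (by norm_num)
    gcongr
  have hgeom : HasSum (fun n : ℕ => 1 / 2 * (1 / 2 : ℝ) ^ n) 1 := by
    simpa using hasSum_geometric_two.mul_left (1 / 2 : ℝ)
  have hdet (z : ℂ) (hz : r₀ ≤ ‖z‖) :
      perturbationDet b H₀ V z = Complex.exp (-∑' n : ℕ, f n z) := by
    have hV : ‖z⁻¹‖ * ‖V‖ ≤ 1 / 4 := le_trans
      (mul_le_mul_of_nonneg_left (le_add_of_nonneg_left (norm_nonneg _)) (norm_nonneg _)) (hwr hz)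
    rw [perturbationDet_eq_exp h b H₀ (hinv hz).1 hH₀ hH ((hwr hz).trans (by norm_num)) hV,
      tsum_momentCoeff_eq b H₀ (Summable.of_norm_bounded hgeom.summable fun n => hbound n z hz)]
  have hsmall (z : ℂ) (hz : r₀ ≤ ‖z‖) : |(-∑' n : ℕ, f n z).im| < Real.pi := by
    have h1 : ‖-∑' n : ℕ, f n z‖ ≤ 1 := by
      rw [norm_neg]
      exact tsum_of_norm_bounded hgeom fun n => hbound n z hz
    linarith [Complex.abs_im_le_norm (-∑' n : ℕ, f n z), Real.pi_gt_three]
  have hlog (z : ℂ) (hz : r₀ ≤ ‖z‖) :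
      Complex.log (perturbationDet b H₀ V z) = -∑' n : ℕ, f n z := by
    rw [hdet z hz, Complex.log_exp (abs_lt.mp (hsmall z hz)).1 (abs_lt.mp (hsmall z hz)).2.le]
  refine ⟨r₀, hr₀, fun z hz => ⟨?_, ?_⟩, ?_⟩
  · refine mem_resolventSet_of_norm_inv_mul_le (hinv hz).1 ?_
    exact (mul_le_mul_of_nonneg_left hH₀ (norm_nonneg _)).trans ((hwr hz).trans (by norm_num))
  · rw [Complex.mem_slitPlane_iff_arg, ← Complex.log_im, hlog z hz]
    refine ⟨((abs_lt.mp (hsmall z hz)).2).ne, ?_⟩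
    rw [hdet z hz]
    exact Complex.exp_ne_zero _
  · have h1 := (tendstoUniformlyOn_tsum_nat (s := {z : ℂ | r₀ ≤ ‖z‖}) hgeom.summable hbound).neg
    refine (h1.congr (Eventually.of_forall fun M z _ => ?_)).congr_right fun z hz =>
      (hlog z hz).symm
    have hsum (M : ℕ) : ∑ n ∈ Finset.Icc 1 M, momentCoeff b H₀ V n / (n : ℂ) * (1 / z) ^ n =
        ∑ n ∈ Finset.range M, f n z := by
      induction M with
      | zero => simp
      | succ M ih =>
        rw [Finset.sum_Icc_succ_top (by omega), ih, Finset.sum_range_succ, one_div]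
    simp only [Pi.neg_apply, hsum]

/-- Cyclicity of the trace for a nuclear and a bounded operator. -/
lemma IsNuclearExpansion.trace_mul_comm (h : IsNuclearExpansion u v V) (b : HilbertBasis ι ℂ E)
    (A : E →L[ℂ] E) : trace b (A * V) = trace b (V * A) := by
  have h1 := (h.mul_mul A 1).trace_eq b
  have h2 := (h.mul_mul 1 A).trace_eq b
  rw [mul_one] at h1
  rw [one_mul] at h2
  rw [h1, h2]
  refine tsum_congr fun k => ?_
  rw [ContinuousLinearMap.adjoint_inner_left, ContinuousLinearMap.adjoint_inner_left]
  rfl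

lemma IsNuclearExpansion.momentCoeff_two (h : IsNuclearExpansion u v V) (b : HilbertBasis ι ℂ E)
    (H₀ : E →L[ℂ] E) :
    IsTraceClass (2 * (V * H₀) + V ^ 2) ∧
      momentCoeff b H₀ V 2 = trace b (2 * (V * H₀) + V ^ 2) := by
  have e1 : 2 * (V * H₀) + V ^ 2 = ∑ j : Fin 3, (1 : E →L[ℂ] E) * V * ![H₀, H₀, V] j := by
    simp [Fin.sum_univ_succ, two_mul, pow_two, add_assoc]
  have e2 : (H₀ + V) ^ 2 - H₀ ^ 2 = ∑ j : Fin 3, ![H₀, 1, 1] j * V * ![1, H₀, V] j := by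
    simp only [Fin.sum_univ_succ, pow_two]
    simp
    noncomm_ring
  rw [e1, momentCoeff, e2]
  refine ⟨h.isTraceClass_sum _ _ _, ?_⟩
  rw [h.trace_sum, h.trace_sum]
  simp [Fin.sum_univ_succ, h.trace_mul_comm b H₀]

end Expansion

end TraceFormula

theorem lemma6p2 {E : Type*} [NormedAddCommGroup E] [InnerProductSpace ℂ E] [CompleteSpace E]
    {ι : Type*} (b : HilbertBasis ι ℂ E) (H₀ V : E →L[ℂ] E)
    (hH₀ : IsSelfAdjoint H₀) (hV : IsSelfAdjoint V) (hVtr : TraceFormula.IsTraceClass V) :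
    (∀ n : ℕ, 1 ≤ n → TraceFormula.IsTraceClass ((H₀ + V) ^ n - H₀ ^ n)) ∧
    (∃ r₀ : ℝ, 0 < r₀ ∧
      (∀ z : ℂ, r₀ ≤ ‖z‖ →
        z ∈ resolventSet ℂ H₀ ∧
        TraceFormula.IsTraceClass (V * TraceFormula.freeResolvent H₀ z) ∧
        TraceFormula.perturbationDet b H₀ V z ∈ Complex.slitPlane) ∧
      TendstoUniformlyOn
        (fun (N : ℕ) (z : ℂ) =>
          -∑ n ∈ Finset.Icc 1 N, TraceFormula.momentCoeff b H₀ V n / (n : ℂ) * (1 / z) ^ n)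
        (fun z : ℂ => Complex.log (TraceFormula.perturbationDet b H₀ V z))
        atTop {z : ℂ | r₀ ≤ ‖z‖}) ∧
    TraceFormula.momentCoeff b H₀ V 1 = TraceFormula.trace b V ∧
    TraceFormula.IsTraceClass (2 * (V * H₀) + V ^ 2) ∧
    TraceFormula.momentCoeff b H₀ V 2 = TraceFormula.trace b (2 * (V * H₀) + V ^ 2) := by
  obtain ⟨s, u, v, h⟩ := hVtr.exists_isNuclearExpansion hV
  obtain ⟨r₀, hr₀, hz, hlim⟩ := TraceFormula.exists_log_perturbationDet_expansion h b H₀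
  refine ⟨fun n _ => h.isTraceClass_pow_sub_pow (add_sub_cancel_left H₀ V) n,
    ⟨r₀, hr₀, fun z hzr => ⟨(hz z hzr).1, ?_, (hz z hzr).2⟩, hlim⟩, ?_, h.momentCoeff_two b H₀⟩
  · simpa using h.isTraceClass_mul_mul 1 (TraceFormula.freeResolvent H₀ z)
  · simp [TraceFormula.momentCoeff]
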